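/- \textbf{Theorem.} Let $A\in\mathbb R^{m\times n}$ have full row rank, let $b\in\mathbb R^m$, $c\in\mathbb R^n$, $\beta>0$ and $\gamma\in(0,1)$. With $e$ the vector of all ones, put $\bar b=b-Ae$, $\bar c=c-e$, $\bar z=c^\top e+1$ and \[ Q=\begin{bmatrix} 0 & A & -b & \bar b\\ -A^\top & 0 & c & -\bar c\\ b^\top & -c^\top & 0 & \bar z\\ -\bar b^\top & \bar c^\top & -\bar z & 0\end{bmatrix},\qquad u=\begin{bmatrix} y\\ x\\ \tau\\ \theta\end{bmatrix},\qquad v=\begin{bmatrix} r\\ s\\ \kappa\\ \xi\end{bmatrix}. \] The simplified ABIP method is the following algorithm. Set $\mu^k=\gamma^k\beta$, so that $\mu^0=\beta$ and $\mu^{k+1}=\gamma\mu^k$. Start from $r_0^0=y_0^0=0$, $x_0^0=s_0^0=e$, $\tau_0^0=\kappa_0^0=\theta_0^0=1$, $\xi_0^0=-n-1$. In the outer (IPM) iteration $k=0,1,2,\dots$ perform, for $i=0,1,2,\dots$, the ADMM iteration \[ \tilde u_{i+1}^k=(I+Q)^{-1}(u_i^k+v_i^k),\qquad y_{i+1}^k=\tilde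 y_{i+1}^k,\qquad \theta_{i+1}^k=\tilde\theta_{i+1}^k, \] \[ x_{i+1}^k=\tfrac12\Big[(\tilde x_{i+1}^k-s_i^k)+\sqrt{(\tilde x_{i+1}^k-s_i^k)^2+4\mu^k/\beta}\,\Big],\qquad \tau_{i+1}^k=\tfrac12\Big[(\tilde \tau_{i+1}^k-\kappa_i^k)+\sqrt{(\tilde \tau_{i+1}^k-\kappa_i^k)^2+4\mu^k/\beta}\,\Big] \] (componentwise for $x$), $v_{i+1}^k=v_i^k-\tilde u_{i+1}^k+u_{i+1}^k$, and stop at the first index $i=N_k\ge 0$ with $\|Qu_i^k-v_i^k\|^2\le(\mu^k)^3$. Then start the next outer iteration from $r_0^{k+1}=0$, $\xi_0^{k+1}=-n-1$ and \[ (y,x,s,\tau,\kappa,\theta)_0^{k+1}=\sqrt\gamma\,(y,x,s,\tau,\kappa,\theta)_{N_k}^k . \] For $\varepsilon>0$ let $T_{\mathsf{IPM}}(\varepsilon)$ be the least $k$ with $\mu^k<\varepsilon$, and let $T_{\mathsf{ADMM}}(\varepsilon)=\sum_{k=0}^{T_{\mathsf{IPM}}(\varepsilon)}N_k$ be the total number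 of ADMM iterations. Then every inner loop terminates ($N_k<\infty$ for all $k$), $T_{\mathsf{IPM}}(\varepsilon)$ is finite for every $\varepsilon>0$, and, as $\varepsilon\downarrow0$, for fixed $A,b,c,\beta,\gamma$, \[ T_{\mathsf{IPM}}(\varepsilon)=O\!\left(\log\frac1\varepsilon\right),\qquad T_{\mathsf{ADMM}}(\varepsilon)=O\!\left(\frac1\varepsilon\log\frac1\varepsilon\right). \] -/

import Mathlib

open Filter Topology Asymptotics

namespace ABIP

/-- Index set of the coordinates of `u = (y, x, τ, θ)` and `v = (r, s, κ, ξ)`. -/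
abbrev Idx (m n : ℕ) : Type := (Fin m ⊕ Fin n) ⊕ (Unit ⊕ Unit)

/-- Coordinates of `y` in `u`, of `r` in `v`. -/
abbrev iy {m n : ℕ} (i : Fin m) : Idx m n := Sum.inl (Sum.inl i)
/-- Coordinates of `x` in `u`, of `s` in `v`. -/
abbrev ix {m n : ℕ} (j : Fin n) : Idx m n := Sum.inl (Sum.inr j)
/-- Coordinate `τ` in `u`, `κ` in `v`. -/
abbrev iτ {m n : ℕ} : Idx m n := Sum.inr (Sum.inl ())
/-- Coordinate `θ` in `u`, `ξ` in `v`. -/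
abbrev iθ {m n : ℕ} : Idx m n := Sum.inr (Sum.inr ())

/-- Assemble a vector from its four blocks. -/
def blocks {m n : ℕ} (y : Fin m → ℝ) (x : Fin n → ℝ) (τ θ : ℝ) : Idx m n → ℝ :=
  Sum.elim (Sum.elim y x) (Sum.elim (fun _ => τ) (fun _ => θ))

section data
variable {m n : ℕ}

/-- `b̄ = b - A e`. -/
def bBar (A : Matrix (Fin m) (Fin n) ℝ) (b : Fin m → ℝ) : Fin m → ℝ :=
  fun i => b i - ∑ j, A i j

/-- `c̄ = c - e`. -/
def cBar (c : Fin n → ℝ) : Fin n → ℝ := fun j => c j - 1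

/-- `z̄ = cᵀ e + 1`. -/
def zBar (c : Fin n → ℝ) : ℝ := (∑ j, c j) + 1

/-- The matrix of the homogeneous self-dual embedding, block rows and columns in the order
`y, x, τ, θ`:
`Q = [[0, A, -b, b̄], [-Aᵀ, 0, c, -c̄], [bᵀ, -cᵀ, 0, z̄], [-b̄ᵀ, c̄ᵀ, -z̄, 0]]`. -/
def Q (A : Matrix (Fin m) (Fin n) ℝ) (b : Fin m → ℝ) (c : Fin n → ℝ) :
    Matrix (Idx m n) (Idx m n) ℝ := fun p =>
  match p with
  | .inl (.inl i) => blocks 0 (fun j => A i j) (-b i) (bBar A b i)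
  | .inl (.inr j) => blocks (fun i => -A i j) 0 (c j) (-cBar c j)
  | .inr (.inl _) => blocks b (-c) 0 (zBar c)
  | .inr (.inr _) => blocks (-bBar A b) (cBar c) (-zBar c) 0

theorem Q_skew (A : Matrix (Fin m) (Fin n) ℝ) (b : Fin m → ℝ) (c : Fin n → ℝ) :
    (Q A b c).transpose = -Q A b c := by
  ext p q
  rcases p with (p | p) | (p | p) <;> rcases q with (q | q) | (q | q) <;>
    simp [Q, blocks, Matrix.transpose_apply]

/-- `I + Q` is invertible, so that the matrix inverse in the affine update is a true inverse. -/
theorem isUnit_one_add_Q (A : Matrix (Fin m) (Fin n) ℝ) (b : Fin m → ℝ) (c : Fin n → ℝ) :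
    IsUnit (1 + Q A b c) := by
  rw [← Matrix.mulVec_injective_iff_isUnit]
  intro w w' h
  have h0 : (1 + Q A b c).mulVec (w - w') = 0 := by
    rw [Matrix.mulVec_sub]; exact sub_eq_zero.2 h
  set d := w - w' with hd
  have hq : d ⬝ᵥ (Q A b c).mulVec d = 0 := by
    have h1 : d ⬝ᵥ (Q A b c).mulVec d = -(d ⬝ᵥ (Q A b c).mulVec d) := by
      conv_lhs => rw [Matrix.dotProduct_mulVec, ← Matrix.mulVec_transpose, Q_skew,
        Matrix.neg_mulVec, neg_dotProduct, dotProduct_comm]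
    linarith
  have h2 : d ⬝ᵥ d = 0 := by
    have h3 := congrArg (fun z => d ⬝ᵥ z) h0
    simp only [Matrix.add_mulVec, Matrix.one_mulVec, dotProduct_add, hq, dotProduct_zero,
      add_zero] at h3
    exact h3
  exact sub_eq_zero.1 (dotProduct_self_eq_zero.1 h2)

end data

/-- The pair `(u, v)` of current iterates. -/
structure State (m n : ℕ) where
  u : Idx m n → ℝ
  v : Idx m n → ℝ

/-- The minimizer over `z > 0` of `-(μ/β) log z + (z - a)² / 2`. -/
noncomputable def barrierProx (β μ a : ℝ) : ℝ := (a + √(a ^ 2 + 4 * μ / β)) / 2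

section algorithm
variable {m n : ℕ}

/-- The initial point: `y = r = 0`, `x = s = e`, `τ = κ = θ = 1`, `ξ = -n - 1`. -/
def initial : State m n where
  u := blocks 0 1 1 1
  v := blocks 0 1 1 (-n - 1)

/-- Affine update `ũ = (I + Q)⁻¹ (u + v)`. -/
noncomputable def affineUpdate (A : Matrix (Fin m) (Fin n) ℝ) (b : Fin m → ℝ) (c : Fin n → ℝ)
    (z : State m n) : Idx m n → ℝ :=
  (1 + Q A b c)⁻¹.mulVec (z.u + z.v)

/-- Barrier update of `u` from `ũ` and `v`. -/
noncomputable def barrierUpdate (β μ : ℝ) (ut v : Idx m n → ℝ) : Idx m n → ℝ :=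
  blocks (fun i => ut (iy i)) (fun j => barrierProx β μ (ut (ix j) - v (ix j)))
    (barrierProx β μ (ut iτ - v iτ)) (ut iθ)

/-- One (inner) ADMM iteration. -/
noncomputable def admmStep (A : Matrix (Fin m) (Fin n) ℝ) (b : Fin m → ℝ) (c : Fin n → ℝ)
    (β μ : ℝ) (z : State m n) : State m n :=
  let ut := affineUpdate A b c z
  let u' := barrierUpdate β μ ut z.v
  { u := u', v := z.v - ut + u' }

/-- The inner stopping criterion `‖Q u - v‖² ≤ μ³`, in the Euclidean norm. -/
def innerStop (A : Matrix (Fin m) (Fin n) ℝ) (b : Fin m → ℝ) (c : Fin n → ℝ)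
    (μ : ℝ) (z : State m n) : Prop :=
  ‖WithLp.toLp 2 ((Q A b c).mulVec z.u - z.v)‖ ^ 2 ≤ μ ^ 3

/-- The starting point of the next outer iteration: `y, x, s, τ, κ, θ` are multiplied by `√γ`,
`r = 0` and `ξ = -n - 1`. -/
noncomputable def warmStart (γ : ℝ) (z : State m n) : State m n where
  u := blocks (fun i => √γ * z.u (iy i)) (fun j => √γ * z.u (ix j)) (√γ * z.u iτ) (√γ * z.u iθ)
  v := blocks 0 (fun j => √γ * z.v (ix j)) (√γ * z.v iτ) (-n - 1)

/-- The barrier parameter `μᵏ`, given by `μ⁰ = β` and `μᵏ⁺¹ = γ μᵏ`. -/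
noncomputable def mu (β γ : ℝ) : ℕ → ℝ
  | 0 => β
  | k + 1 => γ * mu β γ k

/-- The inner iterate number `i` at barrier parameter `μ`, started from `z`. -/
noncomputable def innerIterate (A : Matrix (Fin m) (Fin n) ℝ) (b : Fin m → ℝ) (c : Fin n → ℝ)
    (β μ : ℝ) (z : State m n) (i : ℕ) : State m n :=
  (admmStep A b c β μ)^[i] z

/-- The number of ADMM iterations of the inner loop started from `z`: the first `i` at which the
stopping criterion holds. (This is only meaningful if there is such an `i`.) -/
noncomputable def innerLength (A : Matrix (Fin m) (Fin n) ℝ) (b : Fin m → ℝ) (c : Fin n → ℝ)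
    (β μ : ℝ) (z : State m n) : ℕ :=
  sInf {i : ℕ | innerStop A b c μ (innerIterate A b c β μ z i)}

/-- The starting point `(u₀ᵏ, v₀ᵏ)` of the outer iteration number `k`. -/
noncomputable def outerStart (A : Matrix (Fin m) (Fin n) ℝ) (b : Fin m → ℝ) (c : Fin n → ℝ)
    (β γ : ℝ) : ℕ → State m n
  | 0 => initial
  | k + 1 =>
      let z := outerStart A b c β γ k
      warmStart γ (innerIterate A b c β (mu β γ k) z (innerLength A b c β (mu β γ k) z))

/-- The iterate `(uᵢᵏ, vᵢᵏ)`. -/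
noncomputable def iterate (A : Matrix (Fin m) (Fin n) ℝ) (b : Fin m → ℝ) (c : Fin n → ℝ)
    (β γ : ℝ) (k i : ℕ) : State m n :=
  innerIterate A b c β (mu β γ k) (outerStart A b c β γ k) i

/-- `N_k`, the number of ADMM iterations in the outer iteration number `k`. -/
noncomputable def N (A : Matrix (Fin m) (Fin n) ℝ) (b : Fin m → ℝ) (c : Fin n → ℝ)
    (β γ : ℝ) (k : ℕ) : ℕ :=
  innerLength A b c β (mu β γ k) (outerStart A b c β γ k)

/-- The number of outer (interior point) iterations until `μᵏ < ε`. -/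
noncomputable def T_IPM (β γ ε : ℝ) : ℕ := sInf {k : ℕ | mu β γ k < ε}

/-- The total number of ADMM iterations in the outer loops number `0, …, T_IPM`; the inner loop at
the first parameter below `ε` is counted too. -/
noncomputable def T_ADMM (A : Matrix (Fin m) (Fin n) ℝ) (b : Fin m → ℝ) (c : Fin n → ℝ)
    (β γ ε : ℝ) : ℕ :=
  ∑ k ∈ Finset.range (T_IPM β γ ε + 1), N A b c β γ k

end algorithm

end ABIP

/-! In the variable `w = u - v` one ADMM step is a Douglas–Rachford step, `drMap`: the barrier
update turns `w` into the pair with difference `w`, `r = 0`, `ξ = -n - 1` and `x s = τ κ = μ/β`, and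
the affine update is the resolvent of the skew operator `Q`. Skewness gives an exact energy balance
(`drMap_energy`): the squared distance between two points drops by the squared defect `du - J (du +
dv)` and by `-2⟪du, dv⟫`, which is nonnegative on the barrier curve.

Three facts carry the rest. On bounded sets `-2⟪du, dv⟫` is at least a multiple of `μ/β` times the
squares of `dv` and of the `x, τ` part of `du`; full row rank recovers the `y, θ` part through `Q`,
so a step contracts the squared distance to a fixed point by `1 - ρ μ/β`
(`exists_drMap_contraction`). Fixed points exist in a ball independent of `μ`, because the initial
point satisfies `Q u = v` and the complementarity gap against it bounds `x, s, τ, κ`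
(`exists_drMap_fixedPoint`). A warm start scales `w` by `√γ < 1` up to a bounded shift, so all outer
starts stay at bounded distance from the fixed points (`exists_diff_outerStart_bound`).

As `μ/β = γ^k`, reaching accuracy `μ³` takes `O((k+1) γ⁻ᵏ)` steps (`exists_N_le`). Summed over `k ≤
T` this is `O((T+1) γ⁻ᵀ)`, and minimality of `T` gives `γ⁻ᵀ = O(1/ε)`. -/

namespace ABIP

/-! ### Douglas–Rachford steps and fixed points of nonexpansive maps -/

section abstractDR
variable {E : Type*} [NormedAddCommGroup E] [InnerProductSpace ℝ E]

/-- Energy balance of a Douglas–Rachford step with the resolvent `J` of a skew operator. -/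
theorem resolvent_energy (J : E →ₗ[ℝ] E) (hJ : ∀ a, inner ℝ (J a) (a - J a) = 0) (u v : E) :
    ‖J (u + v) - v‖ ^ 2 + ‖u - J (u + v)‖ ^ 2 = ‖u - v‖ ^ 2 + 2 * inner ℝ u v := by
  have h := hJ (u + v)
  generalize J (u + v) = t at h
  rw [inner_sub_right, inner_add_right] at h
  rw [norm_sub_sq_real, norm_sub_sq_real, norm_sub_sq_real]
  rw [real_inner_self_eq_norm_sq] at h
  have h1 := real_inner_comm u t
  linarith

/-- A nonexpansive map of a finite-dimensional space has a fixed point in the closed ball of radius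
`R` about `0` if the fixed points of all its convex combinations with a constant map lie there. -/
theorem exists_fixedPoint_of_bounded_regularization [FiniteDimensional ℝ E] (T : E → E)
    (hT : ∀ x y, ‖T x - T y‖ ≤ ‖x - y‖) (w₀ : E) (R : ℝ)
    (hR : ∀ t : ℝ, 0 < t → t < 1 → ∀ w, w - w₀ = (1 - t) • (T w - w₀) → ‖w‖ ≤ R) :
    ∃ w, T w = w ∧ ‖w‖ ≤ R := by
  have hTc : LipschitzWith 1 T := LipschitzWith.of_dist_le_mul fun x y => by
    simpa [dist_eq_norm] using hT x y
  have : CompleteSpace E := FiniteDimensional.complete ℝ E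
  have : ProperSpace E := FiniteDimensional.proper ℝ E
  -- Averaging with the constant `w₀` makes `T` a strict contraction; its Banach fixed point is an
  -- approximate fixed point of `T`.
  have key : ∀ t : ℝ, 0 < t → t < 1 →
      ∃ w ∈ Metric.closedBall (0 : E) R, ‖T w - w‖ ≤ t * (‖T w‖ + ‖w₀‖) := by
    intro t ht0 ht1
    let F : E → E := fun w => w₀ + (1 - t) • (T w - w₀)
    have hF : ContractingWith (Real.toNNReal (1 - t)) F := by
      refine ⟨Real.toNNReal_lt_one.2 (by linarith), LipschitzWith.of_dist_le_mul ?_⟩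
      intro x y
      have : F x - F y = (1 - t) • (T x - T y) := by
        simp only [F, smul_sub]; abel
      rw [dist_eq_norm, this, norm_smul, Real.norm_of_nonneg (by linarith), dist_eq_norm,
        Real.coe_toNNReal _ (by linarith)]
      exact mul_le_mul_of_nonneg_left (hT x y) (by linarith)
    have hw := hF.fixedPoint_isFixedPt
    set w := ContractingWith.fixedPoint F hF
    have hw' : w - w₀ = (1 - t) • (T w - w₀) := by
      have : F w = w := hw
      nth_rewrite 1 [← this]
      simp [F]
    refine ⟨w, by simpa using hR t ht0 ht1 w hw', ?_⟩
    have : T w - w = t • (T w - w₀) := by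
      have h2 : T w - w = (T w - w₀) - (w - w₀) := by abel
      rw [h2, hw', sub_smul, one_smul]; abel
    rw [this, norm_smul, Real.norm_of_nonneg ht0.le]
    exact mul_le_mul_of_nonneg_left (norm_sub_le _ _) ht0.le
  have hcont : Continuous fun w => ‖T w - w‖ := (hTc.continuous.sub continuous_id).norm
  obtain ⟨w₁, hw₁, -⟩ := key (1 / 2) (by norm_num) (by norm_num)
  obtain ⟨w, hw, hmin⟩ := (isCompact_closedBall (0 : E) R).exists_isMinOn ⟨w₁, hw₁⟩
    hcont.continuousOn
  refine ⟨w, ?_, by simpa using hw⟩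
  set M : ℝ := ‖T 0‖ + R + ‖w₀‖ with hM
  have hRnn : 0 ≤ R := (norm_nonneg w₁).trans (by simpa using hw₁)
  have hbound : ∀ t : ℝ, 0 < t → t < 1 → ‖T w - w‖ ≤ t * M := by
    intro t ht0 ht1
    obtain ⟨w', hw', h⟩ := key t ht0 ht1
    refine (hmin hw').trans (h.trans (mul_le_mul_of_nonneg_left ?_ ht0.le))
    have h1 := hT w' 0
    have h2 : ‖T w'‖ ≤ ‖T 0‖ + ‖T w' - T 0‖ := by
      simpa using norm_add_le (T 0) (T w' - T 0)
    have h3 : ‖w'‖ ≤ R := by simpa using hw'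
    rw [sub_zero] at h1
    linarith
  have hMnn : 0 ≤ M := by positivity
  by_contra hne
  have hpos : 0 < ‖T w - w‖ := norm_pos_iff.2 (sub_ne_zero.2 hne)
  set e := ‖T w - w‖
  -- This `t` makes `e ≤ t * M` read `e + 2M + 1 ≤ M` after division by `e`, which is absurd.
  have := hbound (e / (e + 2 * M + 1)) (by positivity)
    ((div_lt_one (by positivity)).2 (by linarith))
  rw [div_mul_eq_mul_div, le_div_iff₀ (by positivity)] at this
  nlinarith
end abstractDR

/-- Linear convergence gives the accuracy `τ` after logarithmically many steps. -/
theorem geometric_le_of_log_le {q B τ : ℝ} (hq0 : 0 < q) (hq1 : q ≤ 1) (hB : 0 < B) (hτ : 0 < τ)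
    {i : ℕ} (hi : Real.log (B / τ) / q ≤ i) : (1 - q) ^ i * B ≤ τ := by
  have h1 : (1 - q) ^ i ≤ Real.exp (-(q * i)) := by
    calc (1 - q) ^ i ≤ Real.exp (-q) ^ i :=
          pow_le_pow_left₀ (by linarith) (Real.one_sub_le_exp_neg q) i
      _ = Real.exp (-(q * i)) := by rw [← Real.exp_nat_mul]; ring_nf
  rw [div_le_iff₀ hq0] at hi
  have h2 : Real.exp (-(q * i)) ≤ Real.exp (-Real.log (B / τ)) :=
    Real.exp_le_exp.2 (by linarith)
  rw [Real.exp_neg (Real.log _), Real.exp_log (by positivity), inv_div] at h2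
  have := mul_le_mul_of_nonneg_right (h1.trans h2) hB.le
  rwa [div_mul_cancel₀ _ hB.ne'] at this

/-! ### Linear algebra of `Q` and its resolvent -/

section linear
variable {m n : ℕ}

/-- The indicator of the coordinates `x` and `τ`, which carry the logarithmic barrier. -/
def mask : Idx m n → ℝ := blocks 0 1 1 0

/-- With `x = τ = 0` the rows give `Aᵀy = -c̄θ`, `bᵀy = -z̄θ` and `b̄ᵀy = 0`. Since `b̄ = b - Ae`,
the last one becomes `(n + 1)θ = 0`; then `Aᵀy = 0`, and full row rank forces `y = 0`. -/
theorem eq_zero_of_Q_mulVec_eq_zero (A : Matrix (Fin m) (Fin n) ℝ) (b : Fin m → ℝ)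
    (c : Fin n → ℝ) (hA : A.rank = m) (u : Idx m n → ℝ) (hQ : (Q A b c).mulVec u = 0)
    (hx : ∀ j, u (ix j) = 0) (hτ : u iτ = 0) : u = 0 := by
  have hxrow : ∀ j, ∑ i, A i j * u (iy i) = -(cBar c j * u iθ) := by
    intro j
    have := congrFun hQ (ix j)
    simp [Matrix.mulVec, dotProduct, Q, blocks, hx, hτ] at this
    linarith
  have hτrow : ∑ i, b i * u (iy i) = -(zBar c * u iθ) := by
    have := congrFun hQ iτ
    simp [Matrix.mulVec, dotProduct, Q, blocks, hx, hτ] at this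
    linarith
  have hθrow : ∑ i, bBar A b i * u (iy i) = 0 := by
    have := congrFun hQ iθ
    simp [Matrix.mulVec, dotProduct, Q, blocks, hx, hτ] at this
    linarith
  have hθ : u iθ = 0 := by
    have h1 : ∑ i, bBar A b i * u (iy i) =
        ∑ i, b i * u (iy i) - ∑ j, ∑ i, A i j * u (iy i) := by
      rw [Finset.sum_comm, ← Finset.sum_sub_distrib]
      refine Finset.sum_congr rfl fun i _ => ?_
      rw [bBar, sub_mul, Finset.sum_mul]
    rw [hθrow, hτrow, Finset.sum_congr rfl fun j _ => hxrow j, Finset.sum_neg_distrib,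
      ← Finset.sum_mul] at h1
    have h2 : ∑ j, cBar c j = ∑ j, c j - n := by simp [cBar]
    rw [h2, zBar] at h1
    have h3 : ((n : ℝ) + 1) * u iθ = 0 := by linarith
    exact (mul_eq_zero.1 h3).resolve_left (by positivity)
  have hy : (fun i => u (iy i)) = 0 := by
    have hinj : Function.Injective fun y => Matrix.vecMul y A := by
      rw [Matrix.vecMul_injective_iff, linearIndependent_iff_card_eq_finrank_span, Set.finrank,
        ← Matrix.rank_eq_finrank_span_row, hA, Fintype.card_fin]
    apply hinj
    ext j
    have := hxrow j
    rw [hθ, mul_zero, neg_zero] at this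
    simpa [Matrix.vecMul, dotProduct, mul_comm] using this
  ext p
  rcases p with (i | j) | (_ | _)
  · exact congrFun hy i
  · exact hx j
  · exact hτ
  · exact hθ

/-- `Q` as an operator on Euclidean space. -/
noncomputable def Qop (A : Matrix (Fin m) (Fin n) ℝ) (b : Fin m → ℝ) (c : Fin n → ℝ) :
    EuclideanSpace ℝ (Idx m n) →ₗ[ℝ] EuclideanSpace ℝ (Idx m n) :=
  Matrix.toLpLin 2 2 (Q A b c)

/-- The resolvent `(I + Q)⁻¹` as an operator on Euclidean space. -/
noncomputable def Jop (A : Matrix (Fin m) (Fin n) ℝ) (b : Fin m → ℝ) (c : Fin n → ℝ) :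
    EuclideanSpace ℝ (Idx m n) →ₗ[ℝ] EuclideanSpace ℝ (Idx m n) :=
  Matrix.toLpLin 2 2 (1 + Q A b c)⁻¹

/-- Restriction to the coordinates `x` and `τ`. -/
noncomputable def maskOp : EuclideanSpace ℝ (Idx m n) →ₗ[ℝ] EuclideanSpace ℝ (Idx m n) :=
  Matrix.toLpLin 2 2 (Matrix.diagonal mask)

theorem maskOp_apply (u : EuclideanSpace ℝ (Idx m n)) (p : Idx m n) :
    maskOp u p = mask p * u p := by
  simp [maskOp, Matrix.toLpLin_apply, Matrix.mulVec_diagonal]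

theorem Jop_add_Qop_Jop (A : Matrix (Fin m) (Fin n) ℝ) (b : Fin m → ℝ) (c : Fin n → ℝ)
    (a : EuclideanSpace ℝ (Idx m n)) : Jop A b c a + Qop A b c (Jop A b c a) = a := by
  have h : (1 + Q A b c) * (1 + Q A b c)⁻¹ = 1 :=
    Matrix.mul_nonsing_inv _ ((Matrix.isUnit_iff_isUnit_det _).1 (isUnit_one_add_Q A b c))
  have h2 := congrArg (fun M => M.mulVec a.ofLp) h
  simp only [← Matrix.mulVec_mulVec, Matrix.add_mulVec, Matrix.one_mulVec] at h2
  ext p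
  simpa [Jop, Qop, Matrix.toLpLin_apply] using congrFun h2 p

theorem Jop_add_Qop (A : Matrix (Fin m) (Fin n) ℝ) (b : Fin m → ℝ) (c : Fin n → ℝ)
    (u : EuclideanSpace ℝ (Idx m n)) : Jop A b c (u + Qop A b c u) = u := by
  have h : (1 + Q A b c)⁻¹ * (1 + Q A b c) = 1 :=
    Matrix.nonsing_inv_mul _ ((Matrix.isUnit_iff_isUnit_det _).1 (isUnit_one_add_Q A b c))
  have h2 := congrArg (fun M => M.mulVec u.ofLp) h
  simp only [← Matrix.mulVec_mulVec, Matrix.add_mulVec, Matrix.one_mulVec] at h2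
  ext p
  simpa [Jop, Qop, Matrix.toLpLin_apply] using congrFun h2 p

theorem inner_Qop_self (A : Matrix (Fin m) (Fin n) ℝ) (b : Fin m → ℝ) (c : Fin n → ℝ)
    (u : EuclideanSpace ℝ (Idx m n)) : inner ℝ u (Qop A b c u) = 0 := by
  have h1 : u.ofLp ⬝ᵥ (Q A b c).mulVec u.ofLp = -(u.ofLp ⬝ᵥ (Q A b c).mulVec u.ofLp) := by
    conv_lhs => rw [Matrix.dotProduct_mulVec, ← Matrix.mulVec_transpose, Q_skew,
      Matrix.neg_mulVec, neg_dotProduct, dotProduct_comm]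
  rw [EuclideanSpace.inner_eq_star_dotProduct, dotProduct_comm]
  simp only [star_trivial, Qop, Matrix.toLpLin_apply]
  linarith

theorem inner_Jop (A : Matrix (Fin m) (Fin n) ℝ) (b : Fin m → ℝ) (c : Fin n → ℝ)
    (a : EuclideanSpace ℝ (Idx m n)) : inner ℝ (Jop A b c a) (a - Jop A b c a) = 0 := by
  have h : a - Jop A b c a = Qop A b c (Jop A b c a) :=
    sub_eq_iff_eq_add'.2 (Jop_add_Qop_Jop A b c a).symm
  rw [h, inner_Qop_self]

/-- `Q u - v = (I + Q) (u - (I + Q)⁻¹ (u + v))`. -/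
theorem Qop_sub_eq (A : Matrix (Fin m) (Fin n) ℝ) (b : Fin m → ℝ) (c : Fin n → ℝ)
    (u v : EuclideanSpace ℝ (Idx m n)) :
    Qop A b c u - v = (u - Jop A b c (u + v)) + Qop A b c (u - Jop A b c (u + v)) := by
  have h := Jop_add_Qop_Jop A b c (u + v)
  rw [map_sub]
  have : v = Jop A b c (u + v) + Qop A b c (Jop A b c (u + v)) - u := by rw [h]; abel
  nth_rewrite 1 [this]
  abel

theorem exists_one_add_Qop_bound (A : Matrix (Fin m) (Fin n) ℝ) (b : Fin m → ℝ) (c : Fin n → ℝ) :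
    ∃ K : ℝ, 1 ≤ K ∧ ∀ d, ‖d + Qop A b c d‖ ≤ K * ‖d‖ := by
  refine ⟨1 + ‖(Qop A b c).toContinuousLinearMap‖, by simp, fun d => ?_⟩
  have := (Qop A b c).toContinuousLinearMap.le_opNorm d
  refine (norm_add_le _ _).trans ?_
  rw [LinearMap.coe_toContinuousLinearMap'] at this
  linarith

/-- An injective linear map on a finite-dimensional space is bounded below; here the map is `u ↦ (Q
u, maskOp u)`. -/
theorem exists_norm_le_of_rank (A : Matrix (Fin m) (Fin n) ℝ) (b : Fin m → ℝ) (c : Fin n → ℝ)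
    (hA : A.rank = m) : ∃ K : ℝ, 1 ≤ K ∧ ∀ u, ‖u‖ ≤ K * (‖Qop A b c u‖ + ‖maskOp u‖) := by
  have hker : ((Qop A b c).prod (maskOp (m := m) (n := n))).ker = ⊥ := by
    rw [LinearMap.ker_eq_bot']
    intro u hu
    rw [LinearMap.prod_apply, Prod.mk_eq_zero] at hu
    have h : u.ofLp = 0 := by
      refine eq_zero_of_Q_mulVec_eq_zero A b c hA u.ofLp (congrArg WithLp.ofLp hu.1) ?_ ?_
      · intro j
        have := congrArg (fun z => z.ofLp (ix j)) hu.2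
        simpa [maskOp_apply, mask, blocks] using this
      · have := congrArg (fun z => z.ofLp iτ) hu.2
        simpa [maskOp_apply, mask, blocks] using this
    ext p
    exact congrFun h p
  obtain ⟨K, -, hK⟩ := LinearMap.exists_antilipschitzWith _ hker
  refine ⟨max (K : ℝ) 1, le_max_right _ _, fun u => ?_⟩
  have h := hK.le_mul_norm (map_zero _) u
  have h2 : ‖((Qop A b c).prod (maskOp (m := m) (n := n))) u‖ ≤ ‖Qop A b c u‖ + ‖maskOp u‖ := by
    rw [LinearMap.prod_apply, Prod.norm_def]
    exact max_le (le_add_of_nonneg_right (norm_nonneg _)) (le_add_of_nonneg_left (norm_nonneg _))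
  calc ‖u‖ ≤ _ := h
    _ ≤ max (K : ℝ) 1 * ‖((Qop A b c).prod (maskOp (m := m) (n := n))) u‖ :=
      mul_le_mul_of_nonneg_right (le_max_left _ _) (norm_nonneg _)
    _ ≤ _ := by gcongr
end linear
-- The scalar barrier proximal map
section barrier

theorem barrierProx_pos {β μ : ℝ} (hβ : 0 < β) (hμ : 0 < μ) (a : ℝ) : 0 < barrierProx β μ a := by
  have h : |a| < √(a ^ 2 + 4 * μ / β) := by
    rw [← Real.sqrt_sq_eq_abs]
    exact Real.sqrt_lt_sqrt (sq_nonneg a) (by have : 0 < 4 * μ / β := by positivity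
                                              linarith)
  have := neg_abs_le a
  rw [barrierProx]; linarith

theorem barrierProx_mul {β μ : ℝ} (hβ : 0 < β) (hμ : 0 < μ) (a : ℝ) :
    barrierProx β μ a * (barrierProx β μ a - a) = μ / β := by
  have h := Real.sq_sqrt (x := a ^ 2 + 4 * μ / β) (by positivity)
  rw [barrierProx]
  have : 4 * μ / β = 4 * (μ / β) := by ring
  rw [this] at h ⊢
  linear_combination h / 4

theorem barrierProx_sub_pos {β μ : ℝ} (hβ : 0 < β) (hμ : 0 < μ) (a : ℝ) :
    0 < barrierProx β μ a - a :=
  pos_of_mul_pos_right (by rw [barrierProx_mul hβ hμ]; positivity) (barrierProx_pos hβ hμ a).le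

/-- From `(x - s)² + 4xs = (x + s)²`: on the hyperbola the difference determines the pair, which is
what lets `w` replace `(u, v)`. -/
theorem barrierProx_sub_eq {β μ x s : ℝ} (hx : 0 < x) (hs : 0 < s) (h : x * s = μ / β) :
    barrierProx β μ (x - s) = x := by
  have h1 : (x - s) ^ 2 + 4 * μ / β = (x + s) ^ 2 := by
    rw [mul_div_assoc, ← h]; ring
  rw [barrierProx, h1, Real.sqrt_sq (by positivity)]; ring

theorem le_abs_add_one_of_mul_le_one {x s : ℝ} (hx : 0 < x) (h : x * s ≤ 1) :
    x ≤ |x - s| + 1 := by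
  have := le_abs_self (x - s)
  by_contra! hlt
  have h1 : 1 < s := by linarith
  have h2 : 1 < x := by linarith [abs_nonneg (x - s)]
  nlinarith

/-- Strong monotonicity of `x ↦ -σ/x` on `(0, C]`: `s - s' = -(σ/(x x'))(x - x')` with `x x' ≤ C²`.
The roles of `x` and `s` are symmetric, and adding the two estimates gives the factor 2. -/
theorem sub_mul_sub_le_of_mul_eq {σ C x s x' s' : ℝ} (hx : 0 < x) (hs : 0 < s) (hx' : 0 < x')
    (hs' : 0 < s') (h : x * s = σ) (h' : x' * s' = σ) (hxC : x ≤ C) (hx'C : x' ≤ C)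
    (hsC : s ≤ C) (hs'C : s' ≤ C) :
    2 * ((x - x') * (s - s')) ≤ -(σ / C ^ 2) * ((x - x') ^ 2 + (s - s') ^ 2) := by
  have hC : 0 < C := hx.trans_le hxC
  have hσ : 0 < σ := h ▸ mul_pos hx hs
  have key : ∀ {x s x' s' : ℝ}, 0 < x → 0 < s → 0 < x' → 0 < s' → x * s = σ → x' * s' = σ →
      x ≤ C → x' ≤ C → (x - x') * (s - s') ≤ -(σ / C ^ 2) * (x - x') ^ 2 := by
    intro x s x' s' hx hs hx' hs' h h' hxC hx'C
    have e1 : s - s' = -(σ / (x * x')) * (x - x') := by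
      have e2 : s = σ / x := by rw [← h]; field_simp
      have e3 : s' = σ / x' := by rw [← h']; field_simp
      rw [e2, e3]; field_simp; ring
    have e4 : σ / C ^ 2 ≤ σ / (x * x') := by
      apply div_le_div_of_nonneg_left hσ.le (by positivity)
      nlinarith
    rw [e1]
    nlinarith [mul_le_mul_of_nonneg_right e4 (sq_nonneg (x - x'))]
  have h1 := key hx hs hx' hs' h h' hxC hx'C
  have h2 := key hs hx hs' hx' (by rwa [mul_comm]) (by rwa [mul_comm]) hsC hs'C
  linarith [mul_comm (x - x') (s - s')]

end barrier

/-! ### The barrier curve and the iteration as a map of `w` -/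

section curve
variable {m n : ℕ}

/-- The constant values `r = 0` and `ξ = -n - 1` of the coordinates without barrier. -/
noncomputable def vFix : Idx m n → ℝ := blocks 0 0 0 (-n - 1)

theorem mask_eq_zero_or_one (p : Idx m n) : mask p = 0 ∨ mask p = 1 := by
  rcases p with (i | j) | (_ | _) <;> simp [mask, blocks]

/-- The optimality conditions of the barrier subproblem: `r = 0`, `ξ = -n - 1`, and `x s = σ`,
`τ κ = σ` with positive factors. -/
structure OnCurve (σ : ℝ) (u v : EuclideanSpace ℝ (Idx m n)) : Prop where
  fixed : ∀ p, mask p = 0 → v p = vFix p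
  pos_left : ∀ p, mask p = 1 → 0 < u p
  pos_right : ∀ p, mask p = 1 → 0 < v p
  mul_eq : ∀ p, mask p = 1 → u p * v p = σ

open Classical in
/-- The proximal map of the barrier, as a map of `w = u - v`. -/
noncomputable def primal (β μ : ℝ) (w : EuclideanSpace ℝ (Idx m n)) : EuclideanSpace ℝ (Idx m n) :=
  WithLp.toLp 2 fun p => if mask p = 1 then barrierProx β μ (w p) else w p + vFix p

theorem primal_apply_of_mask_eq_one {β μ : ℝ} {w : EuclideanSpace ℝ (Idx m n)} {p : Idx m n}
    (hp : mask p = 1) : primal β μ w p = barrierProx β μ (w p) := by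
  simp [primal, hp]

theorem primal_apply_of_mask_eq_zero {β μ : ℝ} {w : EuclideanSpace ℝ (Idx m n)} {p : Idx m n}
    (hp : mask p = 0) : primal β μ w p = w p + vFix p := by
  simp [primal, hp]

/-- The dual variable belonging to `primal`. -/
noncomputable def dual (β μ : ℝ) (w : EuclideanSpace ℝ (Idx m n)) : EuclideanSpace ℝ (Idx m n) :=
  primal β μ w - w

theorem primal_sub_dual (β μ : ℝ) (w : EuclideanSpace ℝ (Idx m n)) :
    primal β μ w - dual β μ w = w := by
  rw [dual]; abel

theorem onCurve_primal_dual {β μ : ℝ} (hβ : 0 < β) (hμ : 0 < μ)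
    (w : EuclideanSpace ℝ (Idx m n)) : OnCurve (μ / β) (primal β μ w) (dual β μ w) where
  fixed p hp := by simp [dual, primal_apply_of_mask_eq_zero hp]
  pos_left p hp := by
    rw [primal_apply_of_mask_eq_one hp]; exact barrierProx_pos hβ hμ _
  pos_right p hp := by
    rw [dual, PiLp.sub_apply, primal_apply_of_mask_eq_one hp]; exact barrierProx_sub_pos hβ hμ _
  mul_eq p hp := by
    rw [dual, PiLp.sub_apply, primal_apply_of_mask_eq_one hp]; exact barrierProx_mul hβ hμ _

theorem OnCurve.primal_sub {β μ : ℝ} {u v : EuclideanSpace ℝ (Idx m n)}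
    (h : OnCurve (μ / β) u v) : primal β μ (u - v) = u := by
  ext p
  rcases mask_eq_zero_or_one p with hp | hp
  · rw [primal_apply_of_mask_eq_zero hp, PiLp.sub_apply, h.fixed p hp]; ring
  · rw [primal_apply_of_mask_eq_one hp, PiLp.sub_apply,
      barrierProx_sub_eq (h.pos_left p hp) (h.pos_right p hp) (h.mul_eq p hp)]

theorem OnCurve.dual_sub {β μ : ℝ} {u v : EuclideanSpace ℝ (Idx m n)}
    (h : OnCurve (μ / β) u v) : dual β μ (u - v) = v := by
  rw [dual, h.primal_sub]; abel

/-- Coordinates without barrier contribute nothing, since `v = v'` there; hence all of `v - v'` is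
controlled, but only the masked part of `u - u'`. -/
theorem OnCurve.inner_le {σ C : ℝ} {u v u' v' : EuclideanSpace ℝ (Idx m n)}
    (h : OnCurve σ u v) (h' : OnCurve σ u' v')
    (hu : ∀ p, mask p = 1 → u p ≤ C) (hv : ∀ p, mask p = 1 → v p ≤ C)
    (hu' : ∀ p, mask p = 1 → u' p ≤ C) (hv' : ∀ p, mask p = 1 → v' p ≤ C) :
    2 * inner ℝ (u - u') (v - v') ≤
      -(σ / C ^ 2) * (‖maskOp (u - u')‖ ^ 2 + ‖v - v'‖ ^ 2) := by
  rw [PiLp.inner_apply, EuclideanSpace.real_norm_sq_eq, EuclideanSpace.real_norm_sq_eq,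
    ← Finset.sum_add_distrib, Finset.mul_sum, Finset.mul_sum]
  refine Finset.sum_le_sum fun p _ => ?_
  rw [maskOp_apply]
  rcases mask_eq_zero_or_one p with hp | hp
  · simp [hp, h.fixed p hp, h'.fixed p hp]
  · have := sub_mul_sub_le_of_mul_eq (h.pos_left p hp) (h.pos_right p hp) (h'.pos_left p hp)
      (h'.pos_right p hp) (h.mul_eq p hp) (h'.mul_eq p hp) (hu p hp) (hu' p hp) (hv p hp)
      (hv' p hp)
    simpa [hp, mul_comm] using this

theorem OnCurve.inner_nonpos {σ : ℝ} {u v u' v' : EuclideanSpace ℝ (Idx m n)}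
    (h : OnCurve σ u v) (h' : OnCurve σ u' v') : inner ℝ (u - u') (v - v') ≤ 0 := by
  rw [PiLp.inner_apply]
  refine Finset.sum_nonpos fun p _ => ?_
  rcases mask_eq_zero_or_one p with hp | hp
  · simp [h.fixed p hp, h'.fixed p hp]
  · have h1 := h.pos_left p hp
    have h2 := h.pos_right p hp
    have h3 := h'.pos_left p hp
    have h4 := h'.pos_right p hp
    have h5 := h.mul_eq p hp
    have h6 := h'.mul_eq p hp
    have : (u p - u' p) * (v p - v' p) ≤ 0 := by
      rcases le_total (u p) (u' p) with hle | hle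
      · refine mul_nonpos_of_nonpos_of_nonneg (sub_nonpos.2 hle) (sub_nonneg.2 ?_)
        by_contra! hlt
        nlinarith
      · refine mul_nonpos_of_nonneg_of_nonpos (sub_nonneg.2 hle) (sub_nonpos.2 ?_)
        by_contra! hlt
        nlinarith
    simpa [mul_comm] using this

theorem OnCurve.left_le {σ : ℝ} (hσ : σ ≤ 1) {u v : EuclideanSpace ℝ (Idx m n)}
    (h : OnCurve σ u v) (p : Idx m n) (hp : mask p = 1) : u p ≤ ‖u - v‖ + 1 := by
  have h1 := le_abs_add_one_of_mul_le_one (h.pos_left p hp)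
    ((h.mul_eq p hp).trans_le hσ)
  have h2 := PiLp.norm_apply_le (u - v) p
  rw [PiLp.sub_apply, Real.norm_eq_abs] at h2
  linarith

theorem OnCurve.right_le {σ : ℝ} (hσ : σ ≤ 1) {u v : EuclideanSpace ℝ (Idx m n)}
    (h : OnCurve σ u v) (p : Idx m n) (hp : mask p = 1) : v p ≤ ‖u - v‖ + 1 := by
  have h1 := le_abs_add_one_of_mul_le_one (h.pos_right p hp)
    ((mul_comm _ _).trans_le ((h.mul_eq p hp).trans_le hσ))
  have h2 := PiLp.norm_apply_le (u - v) p
  rw [PiLp.sub_apply, Real.norm_eq_abs, abs_sub_comm] at h2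
  linarith

/-- The ADMM iteration as a map of `w = u - v`. -/
noncomputable def drMap (A : Matrix (Fin m) (Fin n) ℝ) (b : Fin m → ℝ) (c : Fin n → ℝ)
    (β μ : ℝ) (w : EuclideanSpace ℝ (Idx m n)) : EuclideanSpace ℝ (Idx m n) :=
  Jop A b c (primal β μ w + dual β μ w) - dual β μ w

/-- The resolvent balance applied to differences. The pair `(u, v)` need not lie on the curve for
this `μ`, so it may be the initial point as well as a fixed point. -/
theorem drMap_energy (A : Matrix (Fin m) (Fin n) ℝ) (b : Fin m → ℝ) (c : Fin n → ℝ)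
    (β μ : ℝ) (w : EuclideanSpace ℝ (Idx m n)) (u v : EuclideanSpace ℝ (Idx m n)) :
    ‖drMap A b c β μ w - (Jop A b c (u + v) - v)‖ ^ 2 +
      ‖(primal β μ w - u) - Jop A b c ((primal β μ w - u) + (dual β μ w - v))‖ ^ 2 =
      ‖w - (u - v)‖ ^ 2 + 2 * inner ℝ (primal β μ w - u) (dual β μ w - v) := by
  have h := resolvent_energy (Jop A b c) (inner_Jop A b c) (primal β μ w - u) (dual β μ w - v)
  have e1 : primal β μ w - u - (dual β μ w - v) = w - (u - v) := by rw [dual]; abel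
  have e2 : Jop A b c (primal β μ w - u + (dual β μ w - v)) - (dual β μ w - v) =
      drMap A b c β μ w - (Jop A b c (u + v) - v) := by
    rw [drMap, sub_add_sub_comm, map_sub]; abel
  rw [e1, e2] at h
  exact h

theorem drMap_nonexpansive (A : Matrix (Fin m) (Fin n) ℝ) (b : Fin m → ℝ) (c : Fin n → ℝ)
    {β μ : ℝ} (hβ : 0 < β) (hμ : 0 < μ) (w w' : EuclideanSpace ℝ (Idx m n)) :
    ‖drMap A b c β μ w - drMap A b c β μ w'‖ ≤ ‖w - w'‖ := by
  have h := drMap_energy A b c β μ w (primal β μ w') (dual β μ w')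
  have h1 := (onCurve_primal_dual hβ hμ w).inner_nonpos (onCurve_primal_dual hβ hμ w')
  rw [primal_sub_dual] at h
  change ‖drMap A b c β μ w - drMap A b c β μ w'‖ ^ 2 + _ = _ at h
  refine le_of_sq_le_sq ?_ (norm_nonneg _)
  exact (le_add_of_nonneg_right (sq_nonneg _)).trans (h.trans_le (by linarith))

end curve
-- Fixed points and linear convergence
section convergence
variable {m n : ℕ}

theorem onCurve_initial : OnCurve 1 (WithLp.toLp 2 (initial (m := m) (n := n)).u)
    (WithLp.toLp 2 (initial (m := m) (n := n)).v) := by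
  constructor <;> intro p hp <;> rcases p with (i | j) | (_ | _) <;>
    simp_all [mask, initial, vFix, blocks]

/-- This is what `b̄`, `c̄`, `z̄` are designed for: the initial pair is strictly feasible for the
embedding. -/
theorem Qop_initial (A : Matrix (Fin m) (Fin n) ℝ) (b : Fin m → ℝ) (c : Fin n → ℝ) :
    Qop A b c (WithLp.toLp 2 initial.u) = WithLp.toLp 2 initial.v := by
  ext p
  rcases p with (i | j) | (_ | _)
  · simp [Qop, Matrix.toLpLin_apply, Matrix.mulVec, dotProduct, Q, initial, blocks, bBar]
    ring
  · simp [Qop, Matrix.toLpLin_apply, Matrix.mulVec, dotProduct, Q, initial, blocks, cBar]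
  · simp [Qop, Matrix.toLpLin_apply, Matrix.mulVec, dotProduct, Q, initial, blocks, zBar]
  · simp [Qop, Matrix.toLpLin_apply, Matrix.mulVec, dotProduct, Q, initial, blocks, zBar, cBar]
    ring

theorem exists_norm_le_of_coord_le (ι : Type*) [Fintype ι] : ∃ K : ℝ, 0 ≤ K ∧
    ∀ (z : EuclideanSpace ℝ ι) (B : ℝ), 0 ≤ B → (∀ p, |z p| ≤ B) → ‖z‖ ≤ K * B := by
  refine ⟨√(Fintype.card ι), Real.sqrt_nonneg _, fun z B hB h => ?_⟩
  refine le_of_sq_le_sq ?_ (by positivity)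
  rw [EuclideanSpace.real_norm_sq_eq, mul_pow, Real.sq_sqrt (by positivity)]
  calc ∑ p, z p ^ 2 ≤ ∑ _p : ι, B ^ 2 :=
        Finset.sum_le_sum fun p _ => sq_le_sq' (abs_le.1 (h p)).1 (abs_le.1 (h p)).2
    _ = _ := by simp

/-- Against the strictly feasible starting point the complementarity gap controls `x, s, τ, κ`. -/
theorem OnCurve.inner_sub_initial_le {σ : ℝ} (hσ : σ ≤ 1) {u v : EuclideanSpace ℝ (Idx m n)}
    (h : OnCurve σ u v) :
    inner ℝ (u - WithLp.toLp 2 initial.u) (v - WithLp.toLp 2 initial.v) ≤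
      2 * (Fintype.card (Idx m n) : ℝ) - ∑ p, mask p * (u p + v p) := by
  rw [PiLp.inner_apply]
  have : 2 * (Fintype.card (Idx m n) : ℝ) = ∑ _p : Idx m n, 2 := by simp [mul_comm]
  rw [this, ← Finset.sum_sub_distrib]
  refine Finset.sum_le_sum fun p _ => ?_
  have h0 := onCurve_initial (m := m) (n := n)
  rcases mask_eq_zero_or_one p with hp | hp
  · have e : (initial (m := m) (n := n)).v p = vFix p := h0.fixed p hp
    simp [hp, h.fixed p hp, e]
  · have e1 : (initial (m := m) (n := n)).u p = 1 := by
      rcases p with (i | j) | (_ | _) <;> simp_all [mask, initial, blocks]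
    have e2 : (initial (m := m) (n := n)).v p = 1 := by
      rcases p with (i | j) | (_ | _) <;> simp_all [mask, initial, blocks]
    have := h.mul_eq p hp
    simp only [PiLp.sub_apply, e1, e2, hp, RCLike.inner_apply, conj_trivial]
    -- `(u - 1)(v - 1) = σ + 1 - (u + v)` with `σ ≤ 1`.
    nlinarith

/-- Fixed points exist, with a bound that is uniform in the barrier parameter. -/
theorem exists_drMap_fixedPoint (A : Matrix (Fin m) (Fin n) ℝ) (b : Fin m → ℝ) (c : Fin n → ℝ)
    (hA : A.rank = m) {β : ℝ} (hβ : 0 < β) :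
    ∃ R : ℝ, 0 ≤ R ∧ ∀ μ, 0 < μ → μ ≤ β → ∃ w, drMap A b c β μ w = w ∧ ‖w‖ ≤ R := by
  obtain ⟨K, hK1, hK⟩ := exists_norm_le_of_rank A b c hA
  obtain ⟨K₂, hK₂1, hK₂⟩ := exists_one_add_Qop_bound A b c
  obtain ⟨K₃, hK₃0, hK₃⟩ := exists_norm_le_of_coord_le (Idx m n)
  set S : ℝ := 2 * (Fintype.card (Idx m n) : ℝ) with hS
  have hS0 : 0 ≤ S := by positivity
  set a : ℝ := K₃ * S
  set a' : ℝ := K₃ * (S + n + 1)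
  have ha' : 0 ≤ a' := by positivity
  refine ⟨K * (a' + K₂ * (S + 2) + a) + a', by positivity, fun μ hμ hμβ => ?_⟩
  have hσ : μ / β ≤ 1 := (div_le_one hβ).2 hμβ
  refine exists_fixedPoint_of_bounded_regularization _ (drMap_nonexpansive A b c hβ hμ)
    (WithLp.toLp 2 initial.u - WithLp.toLp 2 initial.v) _ fun t ht0 ht1 w hw => ?_
  have hcur := onCurve_primal_dual hβ hμ w
  have hen := drMap_energy A b c β μ w (WithLp.toLp 2 initial.u) (WithLp.toLp 2 initial.v)
  have hJ0 : Jop A b c (WithLp.toLp 2 initial.u + WithLp.toLp 2 initial.v) =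
      WithLp.toLp 2 initial.u := by rw [← Qop_initial A b c, Jop_add_Qop]
  have hgap := hcur.inner_sub_initial_le hσ
  have hd : primal β μ w - WithLp.toLp 2 initial.u - Jop A b c (primal β μ w -
      WithLp.toLp 2 initial.u + (dual β μ w - WithLp.toLp 2 initial.v)) =
      primal β μ w - Jop A b c (primal β μ w + dual β μ w) := by
    rw [sub_add_sub_comm, map_sub, hJ0]; abel
  rw [hd, hJ0, hw, norm_smul, Real.norm_of_nonneg (by linarith)] at hen
  set d := primal β μ w - Jop A b c (primal β μ w + dual β μ w) with hdd
  set X := ‖drMap A b c β μ w - (WithLp.toLp 2 initial.u - WithLp.toLp 2 initial.v)‖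
  -- The regularized equation puts `w` closer to the anchor than its image is, so the distance terms
  -- in `hen` drop out, leaving `‖d‖² ≤ 2⟪u - u₀, v - v₀⟫`. With `hgap` this bounds both `d` and the
  -- masked coordinates, uniformly in `t` and `μ`.
  have hX : ((1 - t) * X) ^ 2 ≤ X ^ 2 := by
    rw [mul_pow]
    exact mul_le_of_le_one_left (sq_nonneg X) (pow_le_one₀ (by linarith) (by linarith))
  have hterm : ∀ p, 0 ≤ mask p * (primal β μ w p + dual β μ w p) := by
    intro p
    rcases mask_eq_zero_or_one p with hp | hp
    · simp [hp]
    · rw [hp, one_mul]; exact (add_pos (hcur.pos_left p hp) (hcur.pos_right p hp)).le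
  have hsum := Finset.sum_nonneg fun p (_ : p ∈ Finset.univ) => hterm p
  have hd2 : ‖d‖ ≤ S + 2 := by
    nlinarith [norm_nonneg d]
  have hmaskle : ∀ p, mask p * (primal β μ w p + dual β μ w p) ≤ S := by
    intro p
    have := Finset.single_le_sum (fun p _ => hterm p) (Finset.mem_univ p)
    nlinarith [sq_nonneg ‖d‖]
  have hmu : ‖maskOp (primal β μ w)‖ ≤ a := by
    refine hK₃ _ _ hS0 fun p => ?_
    rw [maskOp_apply]
    rcases mask_eq_zero_or_one p with hp | hp
    · simpa [hp] using hS0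
    · have h1 := hmaskle p
      have h2 := hcur.pos_left p hp
      have h3 := hcur.pos_right p hp
      rw [hp, one_mul] at h1 ⊢
      rw [abs_of_pos h2]; linarith
  have hdual : ‖dual β μ w‖ ≤ a' := by
    refine hK₃ _ _ (by positivity) fun p => ?_
    rcases mask_eq_zero_or_one p with hp | hp
    · rw [hcur.fixed p hp]
      rcases p with (i | j) | (_ | _)
      · simp [vFix, blocks]; positivity
      · simp [vFix, blocks]; positivity
      · simp [vFix, blocks]; positivity
      · have : |(-n - 1 : ℝ)| = n + 1 := by rw [abs_of_neg] <;> linarith [n.cast_nonneg (α := ℝ)]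
        simp [vFix, blocks, this]; linarith
    · have h1 := hmaskle p
      have h2 := hcur.pos_left p hp
      have h3 := hcur.pos_right p hp
      rw [hp, one_mul] at h1
      rw [abs_of_pos h3]; linarith [n.cast_nonneg (α := ℝ)]
  -- The gap says nothing about `y` and `θ`; they are bounded through `Q u = v + (I + Q) d` and the
  -- rank estimate.
  have hQ : ‖Qop A b c (primal β μ w)‖ ≤ a' + K₂ * (S + 2) := by
    have h1 := Qop_sub_eq A b c (primal β μ w) (dual β μ w)
    rw [← hdd, sub_eq_iff_eq_add'] at h1
    rw [h1]
    refine (norm_add_le _ _).trans (add_le_add hdual ((hK₂ d).trans ?_))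
    exact mul_le_mul_of_nonneg_left hd2 (by linarith)
  have hu : ‖primal β μ w‖ ≤ K * (a' + K₂ * (S + 2) + a) :=
    (hK _).trans (mul_le_mul_of_nonneg_left (add_le_add hQ hmu) (by linarith))
  calc ‖w‖ = ‖primal β μ w - dual β μ w‖ := by rw [primal_sub_dual]
    _ ≤ _ := (norm_sub_le _ _).trans (add_le_add hu hdual)

/-- The distance `‖du - dv‖` is controlled by the `x, τ`-part of `du`, by `dv`, and by the defect
of the affine equation. -/
theorem exists_norm_sub_sq_le (A : Matrix (Fin m) (Fin n) ℝ) (b : Fin m → ℝ) (c : Fin n → ℝ)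
    (hA : A.rank = m) : ∃ L : ℝ, 1 ≤ L ∧ ∀ du dv, ‖du - dv‖ ^ 2 ≤
      L * (‖du - Jop A b c (du + dv)‖ ^ 2 + (‖maskOp du‖ ^ 2 + ‖dv‖ ^ 2)) := by
  obtain ⟨K, hK1, hK⟩ := exists_norm_le_of_rank A b c hA
  obtain ⟨K₂, hK₂1, hK₂⟩ := exists_one_add_Qop_bound A b c
  have hL : 1 ≤ K * K₂ + K + 1 := by nlinarith
  refine ⟨3 * (K * K₂ + K + 1) ^ 2, by nlinarith, fun du dv => ?_⟩
  have hQ : ‖Qop A b c du‖ ≤ ‖dv‖ + K₂ * ‖du - Jop A b c (du + dv)‖ := by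
    have h1 := Qop_sub_eq A b c du dv
    rw [sub_eq_iff_eq_add'] at h1
    rw [h1]
    exact (norm_add_le _ _).trans (add_le_add le_rfl (hK₂ _))
  have h1 := norm_sub_le du dv
  have h2 := (hK du).trans (mul_le_mul_of_nonneg_left
    (add_le_add_left hQ ‖maskOp du‖) (zero_le_one.trans hK1))
  have p1 := norm_nonneg (du - Jop A b c (du + dv))
  have p2 := norm_nonneg (maskOp du)
  have p3 := norm_nonneg dv
  have p4 := norm_nonneg (du - dv)
  generalize ‖du - Jop A b c (du + dv)‖ = x at *
  generalize ‖maskOp du‖ = y at *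
  generalize ‖dv‖ = z at *
  generalize ‖du - dv‖ = w at *
  have hw : w ≤ (K * K₂ + K + 1) * (x + z + y) := by
    have q1 : 0 ≤ K * x := by positivity
    have q2 : 0 ≤ K * K₂ * z := by positivity
    have q3 : 0 ≤ K * K₂ * y := by positivity
    linarith
  calc w ^ 2 ≤ ((K * K₂ + K + 1) * (x + z + y)) ^ 2 := pow_le_pow_left₀ p4 hw 2
    _ = (K * K₂ + K + 1) ^ 2 * (x + z + y) ^ 2 := mul_pow _ _ _
    _ ≤ (K * K₂ + K + 1) ^ 2 * (3 * (x ^ 2 + (y ^ 2 + z ^ 2))) := by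
      refine mul_le_mul_of_nonneg_left ?_ (sq_nonneg _)
      linarith [sq_nonneg (x - z), sq_nonneg (x - y), sq_nonneg (z - y)]
    _ = _ := by ring

/-- Bounded trajectories contract towards the fixed point at a linear rate proportional to the
barrier parameter. -/
theorem exists_drMap_contraction (A : Matrix (Fin m) (Fin n) ℝ) (b : Fin m → ℝ) (c : Fin n → ℝ)
    (hA : A.rank = m) {β : ℝ} (hβ : 0 < β) {R D : ℝ} (hR : 0 ≤ R) (hD : 0 ≤ D) :
    ∃ ρ : ℝ, 0 < ρ ∧ ρ ≤ 1 ∧ ∀ μ, 0 < μ → μ ≤ β → ∀ w' w, drMap A b c β μ w' = w' → ‖w'‖ ≤ R →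
      ‖w - w'‖ ≤ D →
      ‖drMap A b c β μ w - w'‖ ^ 2 ≤ (1 - ρ * (μ / β)) * ‖w - w'‖ ^ 2 := by
  obtain ⟨L, hL, hLle⟩ := exists_norm_sub_sq_le A b c hA
  set C : ℝ := D + R + 1
  have hC : 1 ≤ C := by simp only [C]; linarith
  have hCL : 1 ≤ L * C ^ 2 := one_le_mul_of_one_le_of_one_le hL (one_le_pow₀ hC)
  -- Monotonicity gains the factor `(μ/β)/C²`, and `L` converts the gained terms into `‖w - w'‖²`.
  -- The defect enters the balance with coefficient 1, which is more than needed.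
  refine ⟨1 / (L * C ^ 2), by positivity, (div_le_one (by positivity)).2 hCL, ?_⟩
  intro μ hμ hμβ w' w hfix hw'R hwD
  have hσ : μ / β ≤ 1 := (div_le_one hβ).2 hμβ
  have hσ0 : 0 < μ / β := by positivity
  have hcur := onCurve_primal_dual hβ hμ w
  have hcur' := onCurve_primal_dual hβ hμ w'
  have hw : ‖w‖ ≤ D + R := by
    have := norm_add_le (w - w') w'
    rw [sub_add_cancel] at this; linarith
  have hu : ∀ p, mask p = 1 → primal β μ w p ≤ C := fun p hp => by
    have := hcur.left_le hσ p hp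
    rw [primal_sub_dual] at this; simp only [C]; linarith
  have hv : ∀ p, mask p = 1 → dual β μ w p ≤ C := fun p hp => by
    have := hcur.right_le hσ p hp
    rw [primal_sub_dual] at this; simp only [C]; linarith
  have hu' : ∀ p, mask p = 1 → primal β μ w' p ≤ C := fun p hp => by
    have := hcur'.left_le hσ p hp
    rw [primal_sub_dual] at this; simp only [C]; linarith
  have hv' : ∀ p, mask p = 1 → dual β μ w' p ≤ C := fun p hp => by
    have := hcur'.right_le hσ p hp
    rw [primal_sub_dual] at this; simp only [C]; linarith
  have hin := hcur.inner_le hcur' hu hv hu' hv'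
  have hen := drMap_energy A b c β μ w (primal β μ w') (dual β μ w')
  have hT : Jop A b c (primal β μ w' + dual β μ w') - dual β μ w' = w' := hfix
  rw [primal_sub_dual, hT] at hen
  set du := primal β μ w - primal β μ w' with hdu
  set dv := dual β μ w - dual β μ w' with hdv
  set d := du - Jop A b c (du + dv) with hd
  have hw2 : ‖w - w'‖ ^ 2 ≤ L * (‖d‖ ^ 2 + (‖maskOp du‖ ^ 2 + ‖dv‖ ^ 2)) := by
    have e : w - w' = du - dv := by
      rw [hdu, hdv, sub_sub_sub_comm, primal_sub_dual, primal_sub_dual]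
    rw [e]; exact hLle du dv
  have hδ : μ / β / C ^ 2 ≤ 1 :=
    (div_le_one (by positivity)).2 (hσ.trans (one_le_pow₀ hC))
  have hδ0 : 0 < μ / β / C ^ 2 := by positivity
  have hloss : 1 / (L * C ^ 2) * (μ / β) * ‖w - w'‖ ^ 2 ≤
      μ / β / C ^ 2 * (‖d‖ ^ 2 + (‖maskOp du‖ ^ 2 + ‖dv‖ ^ 2)) := by
    have h1 := mul_le_mul_of_nonneg_left hw2
      (by positivity : 0 ≤ 1 / (L * C ^ 2) * (μ / β))
    refine h1.trans_eq ?_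
    field_simp
  have hdd : μ / β / C ^ 2 * ‖d‖ ^ 2 ≤ ‖d‖ ^ 2 := mul_le_of_le_one_left (sq_nonneg _) hδ
  linarith

theorem iterate_drMap_norm_sub_le (A : Matrix (Fin m) (Fin n) ℝ) (b : Fin m → ℝ) (c : Fin n → ℝ)
    {β μ : ℝ} (hβ : 0 < β) (hμ : 0 < μ) {w' : EuclideanSpace ℝ (Idx m n)}
    (hfix : drMap A b c β μ w' = w') (w : EuclideanSpace ℝ (Idx m n)) (i : ℕ) :
    ‖(drMap A b c β μ)^[i] w - w'‖ ≤ ‖w - w'‖ := by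
  induction i with
  | zero => simp
  | succ i ih =>
    rw [Function.iterate_succ_apply']
    have := drMap_nonexpansive A b c hβ hμ ((drMap A b c β μ)^[i] w) w'
    rw [hfix] at this
    exact this.trans ih

/-- The residual of the affine equation is controlled by the distance to a fixed point. -/
theorem residual_le (A : Matrix (Fin m) (Fin n) ℝ) (b : Fin m → ℝ) (c : Fin n → ℝ)
    {β μ : ℝ} (hβ : 0 < β) (hμ : 0 < μ) {K : ℝ} (hK0 : 0 ≤ K)
    (hK : ∀ d, ‖d + Qop A b c d‖ ≤ K * ‖d‖) {w' : EuclideanSpace ℝ (Idx m n)}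
    (hfix : drMap A b c β μ w' = w') (w : EuclideanSpace ℝ (Idx m n)) :
    ‖Qop A b c (primal β μ w) - dual β μ w‖ ≤ K * ‖w - w'‖ := by
  rw [Qop_sub_eq]
  refine (hK _).trans (mul_le_mul_of_nonneg_left ?_ hK0)
  have hen := drMap_energy A b c β μ w (primal β μ w') (dual β μ w')
  have hT : Jop A b c (primal β μ w' + dual β μ w') = primal β μ w' := by
    have : Jop A b c (primal β μ w' + dual β μ w') - dual β μ w' = w' := hfix
    rw [sub_eq_iff_eq_add] at this
    rw [this, dual]; abel
  have hin := (onCurve_primal_dual hβ hμ w).inner_nonpos (onCurve_primal_dual hβ hμ w')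
  have e : primal β μ w - primal β μ w' - Jop A b c (primal β μ w - primal β μ w' +
      (dual β μ w - dual β μ w')) = primal β μ w - Jop A b c (primal β μ w + dual β μ w) := by
    rw [sub_add_sub_comm, map_sub, hT]; abel
  rw [e, primal_sub_dual] at hen
  refine le_of_sq_le_sq ?_ (norm_nonneg _)
  exact (le_add_of_nonneg_left (sq_nonneg _)).trans (hen.trans_le (by linarith))

end convergence
-- The algorithm's trajectory and the inner iteration count
section trajectory
variable {m n : ℕ}

/-- The Douglas–Rachford variable `w = u - v` of a pair of iterates. -/
noncomputable def State.diff (z : State m n) : EuclideanSpace ℝ (Idx m n) :=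
  WithLp.toLp 2 z.u - WithLp.toLp 2 z.v

/-- A pair of iterates satisfying the optimality conditions of the barrier subproblem. -/
def State.OnCurve (σ : ℝ) (z : State m n) : Prop :=
  ABIP.OnCurve σ (WithLp.toLp 2 z.u) (WithLp.toLp 2 z.v)

/-- On the `y, θ` coordinates `primal` adds `vFix` back, which cancels the subtracted `v` because
`r` and `ξ` are constant on the curve. -/
theorem barrierUpdate_eq_primal {β μ σ : ℝ} {z : State m n} (hz : z.OnCurve σ)
    (ut : Idx m n → ℝ) : WithLp.toLp 2 (barrierUpdate β μ ut z.v) =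
      primal β μ (WithLp.toLp 2 ut - WithLp.toLp 2 z.v) := by
  ext p
  rcases mask_eq_zero_or_one p with hp | hp
  · rw [primal_apply_of_mask_eq_zero hp]
    have h : z.v p = vFix p := hz.fixed p hp
    rw [PiLp.sub_apply]
    change _ = ut p - z.v p + _
    rw [← h, sub_add_cancel]
    rcases p with (i | j) | (_ | _) <;> simp_all [barrierUpdate, blocks, mask]
  · rw [primal_apply_of_mask_eq_one hp]
    rcases p with (i | j) | (_ | _) <;> simp_all [barrierUpdate, blocks, mask]

theorem diff_admmStep_eq (A : Matrix (Fin m) (Fin n) ℝ) (b : Fin m → ℝ) (c : Fin n → ℝ)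
    (β μ : ℝ) (z : State m n) : (admmStep A b c β μ z).diff =
      WithLp.toLp 2 (affineUpdate A b c z) - WithLp.toLp 2 z.v := by
  ext p
  simp [State.diff, admmStep]

theorem toLp_affineUpdate (A : Matrix (Fin m) (Fin n) ℝ) (b : Fin m → ℝ) (c : Fin n → ℝ)
    (z : State m n) : WithLp.toLp 2 (affineUpdate A b c z) =
      Jop A b c (WithLp.toLp 2 z.u + WithLp.toLp 2 z.v) := rfl

theorem State.OnCurve.diff_admmStep (A : Matrix (Fin m) (Fin n) ℝ) (b : Fin m → ℝ)
    (c : Fin n → ℝ) {β μ : ℝ} {z : State m n} (hz : z.OnCurve (μ / β)) :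
    (admmStep A b c β μ z).diff = drMap A b c β μ z.diff := by
  rw [diff_admmStep_eq, toLp_affineUpdate, drMap, State.diff, hz.primal_sub, hz.dual_sub]

theorem State.OnCurve.admmStep (A : Matrix (Fin m) (Fin n) ℝ) (b : Fin m → ℝ)
    (c : Fin n → ℝ) {β μ : ℝ} (hβ : 0 < β) (hμ : 0 < μ) {z : State m n}
    (hz : z.OnCurve (μ / β)) : (ABIP.admmStep A b c β μ z).OnCurve (μ / β) := by
  have h1 : WithLp.toLp 2 (ABIP.admmStep A b c β μ z).u =
      primal β μ (ABIP.admmStep A b c β μ z).diff := by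
    rw [diff_admmStep_eq]
    exact barrierUpdate_eq_primal hz _
  have h2 : WithLp.toLp 2 (ABIP.admmStep A b c β μ z).v =
      dual β μ (ABIP.admmStep A b c β μ z).diff := by
    rw [dual, ← h1, State.diff]; abel
  rw [State.OnCurve, h1, h2]
  exact onCurve_primal_dual hβ hμ _

theorem State.OnCurve.innerIterate (A : Matrix (Fin m) (Fin n) ℝ) (b : Fin m → ℝ)
    (c : Fin n → ℝ) {β μ : ℝ} (hβ : 0 < β) (hμ : 0 < μ) {z : State m n}
    (hz : z.OnCurve (μ / β)) (i : ℕ) :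
    (ABIP.innerIterate A b c β μ z i).OnCurve (μ / β) ∧
      (ABIP.innerIterate A b c β μ z i).diff = (drMap A b c β μ)^[i] z.diff := by
  induction i with
  | zero => exact ⟨hz, rfl⟩
  | succ i ih =>
    have e : ABIP.innerIterate A b c β μ z (i + 1) =
        ABIP.admmStep A b c β μ (ABIP.innerIterate A b c β μ z i) :=
      Function.iterate_succ_apply' _ _ _
    rw [e, Function.iterate_succ_apply', ← ih.2]
    exact ⟨ih.1.admmStep A b c hβ hμ, ih.1.diff_admmStep A b c⟩

theorem State.OnCurve.warmStart {γ σ : ℝ} (hγ : 0 < γ) {z : State m n} (hz : z.OnCurve σ) :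
    (warmStart γ z).OnCurve (γ * σ) := by
  have hs : 0 < √γ := Real.sqrt_pos.2 hγ
  have key : ∀ p : Idx m n, mask p = 1 → (ABIP.warmStart γ z).u p = √γ * z.u p ∧
      (ABIP.warmStart γ z).v p = √γ * z.v p := by
    intro p hp
    rcases p with (i | j) | (_ | _) <;> simp_all [mask, blocks, ABIP.warmStart]
  constructor
  · intro p hp
    rcases p with (i | j) | (_ | _) <;> simp_all [mask, blocks, ABIP.warmStart, vFix]
  · intro p hp
    exact (mul_pos hs (hz.pos_left p hp)).trans_eq (key p hp).1.symm
  · intro p hp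
    exact (mul_pos hs (hz.pos_right p hp)).trans_eq (key p hp).2.symm
  · intro p hp
    have h : z.u p * z.v p = σ := hz.mul_eq p hp
    change (ABIP.warmStart γ z).u p * (ABIP.warmStart γ z).v p = _
    rw [(key p hp).1, (key p hp).2]
    linear_combination (z.u p * z.v p) * (Real.mul_self_sqrt hγ.le) + γ * h

/-- The shift appears because `ξ` is reset to `-n - 1` instead of being scaled by `√γ`; `r` is zero
either way. -/
theorem State.OnCurve.diff_warmStart {γ σ : ℝ} {z : State m n} (hz : z.OnCurve σ) :
    (ABIP.warmStart γ z).diff =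
      √γ • z.diff + EuclideanSpace.single iθ ((1 - √γ) * (n + 1 : ℝ)) := by
  ext p
  have h : mask p = 0 → z.v p = vFix p := hz.fixed p
  rcases p with (i | j) | (_ | _)
  · have := h (by simp [mask, blocks])
    simp [State.diff, ABIP.warmStart, blocks, this, vFix]
  · simp [State.diff, ABIP.warmStart, blocks, mul_sub]
  · simp [State.diff, ABIP.warmStart, blocks, mul_sub]
  · have := h (by simp [mask, blocks])
    simp [State.diff, ABIP.warmStart, blocks, this, vFix]
    ring

theorem mu_eq (β γ : ℝ) (k : ℕ) : mu β γ k = γ ^ k * β := by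
  induction k with
  | zero => simp [mu]
  | succ k ih => rw [mu, ih]; ring

theorem onCurve_outerStart (A : Matrix (Fin m) (Fin n) ℝ) (b : Fin m → ℝ)
    (c : Fin n → ℝ) {β γ : ℝ} (hβ : 0 < β) (hγ0 : 0 < γ) (k : ℕ) :
    (outerStart A b c β γ k).OnCurve (mu β γ k / β) := by
  induction k with
  | zero =>
    rw [mu, div_self hβ.ne']
    exact onCurve_initial
  | succ k ih =>
    rw [mu, mul_div_assoc]
    have hμ : 0 < mu β γ k := by rw [mu_eq]; positivity
    exact ((ih.innerIterate A b c hβ hμ _).1).warmStart hγ0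

/-- The outer starting points stay at bounded distance from the central path. -/
theorem exists_diff_outerStart_bound (A : Matrix (Fin m) (Fin n) ℝ) (b : Fin m → ℝ)
    (c : Fin n → ℝ) {β γ : ℝ} (hβ : 0 < β) (hγ0 : 0 < γ) (hγ1 : γ < 1) {R : ℝ} (hR : 0 ≤ R)
    (w : ℕ → EuclideanSpace ℝ (Idx m n)) (hfix : ∀ k, drMap A b c β (mu β γ k) (w k) = w k)
    (hw : ∀ k, ‖w k‖ ≤ R) :
    ∃ D : ℝ, 0 < D ∧ ∀ k, ‖(outerStart A b c β γ k).diff - w k‖ ≤ D := by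
  have hs1 : √γ < 1 := by rw [Real.sqrt_lt' one_pos]; simpa using hγ1
  have hs0 : 0 ≤ √γ := Real.sqrt_nonneg γ
  have hs : 0 < 1 - √γ := by linarith
  -- The fixed point of the recursion `D ↦ √γ D + 2R + n + 1`: `2R` for the old and new fixed
  -- points, `n + 1` for the warm-start shift.
  set D₀ := (2 * R + n + 1) / (1 - √γ) with hD₀
  have hD₀pos : 0 < D₀ := by positivity
  have hD₀eq : (1 - √γ) * D₀ = 2 * R + n + 1 := by rw [hD₀]; field_simp
  set D := ‖(initial (m := m) (n := n)).diff‖ + R + D₀ with hD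
  refine ⟨D, by positivity, fun k => ?_⟩
  induction k with
  | zero =>
    have h1 := norm_sub_le (initial (m := m) (n := n)).diff (w 0)
    have h2 := hw 0
    exact h1.trans (by linarith)
  | succ k ih =>
    have hμ : 0 < mu β γ k := by rw [mu_eq]; positivity
    have hcur := (onCurve_outerStart A b c hβ hγ0 k).innerIterate A b c hβ hμ
      (innerLength A b c β (mu β γ k) (outerStart A b c β γ k))
    have hit := iterate_drMap_norm_sub_le A b c hβ hμ (hfix k) (outerStart A b c β γ k).diff
      (innerLength A b c β (mu β γ k) (outerStart A b c β γ k))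
    rw [← hcur.2] at hit
    rw [outerStart, hcur.1.diff_warmStart]
    set z := ABIP.innerIterate A b c β (mu β γ k) (outerStart A b c β γ k)
      (innerLength A b c β (mu β γ k) (outerStart A b c β γ k))
    set e : EuclideanSpace ℝ (Idx m n) := EuclideanSpace.single iθ ((1 - √γ) * (n + 1 : ℝ))
    have he : ‖e‖ ≤ n + 1 := by
      rw [PiLp.norm_single, Real.norm_of_nonneg (by positivity)]
      exact mul_le_of_le_one_left (by positivity) (by linarith)
    have e1 : √γ • z.diff + e - w (k + 1) = √γ • (z.diff - w k) + √γ • w k + e - w (k + 1) := by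
      rw [smul_sub]; abel
    have n1 : ‖√γ • (z.diff - w k)‖ ≤ √γ * D := by
      rw [norm_smul, Real.norm_of_nonneg hs0]
      exact mul_le_mul_of_nonneg_left (hit.trans ih) hs0
    have n2 : ‖√γ • w k‖ ≤ R := by
      rw [norm_smul, Real.norm_of_nonneg hs0]
      exact (mul_le_of_le_one_left (norm_nonneg _) hs1.le).trans (hw k)
    have n3 : (1 - √γ) * D₀ ≤ (1 - √γ) * D := by
      refine mul_le_mul_of_nonneg_left ?_ hs.le
      rw [hD]; linarith [norm_nonneg (initial (m := m) (n := n)).diff]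
    rw [e1]
    refine (norm_sub_le _ _).trans ?_
    have n4 := norm_add₃_le (a := √γ • (z.diff - w k)) (b := √γ • w k) (c := e)
    linarith [hw (k + 1)]

/-- Every inner loop terminates, after `O((k + 1) γ⁻ᵏ)` iterations. -/
theorem exists_N_le (A : Matrix (Fin m) (Fin n) ℝ) (b : Fin m → ℝ) (c : Fin n → ℝ)
    (hA : A.rank = m) {β γ : ℝ} (hβ : 0 < β) (hγ0 : 0 < γ) (hγ1 : γ < 1) :
    ∃ C : ℝ, 0 < C ∧ ∀ k : ℕ, (∃ i, innerStop A b c (mu β γ k) (iterate A b c β γ k i)) ∧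
      (N A b c β γ k : ℝ) ≤ C * ((k + 1) * (γ⁻¹) ^ k) := by
  obtain ⟨R, hR, hfix⟩ := exists_drMap_fixedPoint A b c hA hβ
  have hμ : ∀ k, 0 < mu β γ k := fun k => by rw [mu_eq]; positivity
  have hμβ : ∀ k, mu β γ k ≤ β := fun k => by
    rw [mu_eq]; exact mul_le_of_le_one_left hβ.le (pow_le_one₀ hγ0.le hγ1.le)
  choose w hwfix hwR using fun k => hfix (mu β γ k) (hμ k) (hμβ k)
  obtain ⟨D, hD, hstart⟩ := exists_diff_outerStart_bound A b c hβ hγ0 hγ1 hR w hwfix hwR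
  obtain ⟨ρ, hρ0, hρ1, hcontr⟩ := exists_drMap_contraction A b c hA hβ hR hD.le
  obtain ⟨K, hK1, hK⟩ := exists_one_add_Qop_bound A b c
  set B := (K * D) ^ 2 with hB
  have hB0 : 0 < B := by positivity
  have hq1 : ∀ k : ℕ, ρ * γ ^ k ≤ 1 := fun k =>
    mul_le_one₀ hρ1 (by positivity) (pow_le_one₀ hγ0.le hγ1.le)
  have hterm : ∀ k i : ℕ, Real.log (B / mu β γ k ^ 3) / (ρ * γ ^ k) ≤ i →
      innerStop A b c (mu β γ k) (iterate A b c β γ k i) := by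
    intro k i hi
    have hgeo := geometric_le_of_log_le (by positivity) (hq1 k) hB0 (pow_pos (hμ k) 3) hi
    have hcur := (onCurve_outerStart A b c hβ hγ0 k).innerIterate A b c hβ (hμ k)
    have hconv : ∀ i, ‖(iterate A b c β γ k i).diff - w k‖ ^ 2 ≤ (1 - ρ * γ ^ k) ^ i * D ^ 2 := by
      intro i
      rw [ABIP.iterate, (hcur i).2]
      induction i with
      | zero => simpa using pow_le_pow_left₀ (norm_nonneg _) (hstart k) 2
      | succ i ih =>
        rw [Function.iterate_succ_apply']
        have h1 := hcontr (mu β γ k) (hμ k) (hμβ k) (w k) _ (hwfix k) (hwR k)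
          ((iterate_drMap_norm_sub_le A b c hβ (hμ k) (hwfix k) _ i).trans (hstart k))
        have h2 : mu β γ k / β = γ ^ k := by rw [mu_eq, mul_div_cancel_right₀ _ hβ.ne']
        rw [h2] at h1
        refine h1.trans ?_
        rw [pow_succ' (1 - ρ * γ ^ k), mul_assoc]
        exact mul_le_mul_of_nonneg_left ih (by linarith [hq1 k])
    have hres := residual_le A b c hβ (hμ k) (by linarith) hK (hwfix k)
      (iterate A b c β γ k i).diff
    have hp := (hcur i).1
    have e1 : primal β (mu β γ k) (iterate A b c β γ k i).diff =
        WithLp.toLp 2 (iterate A b c β γ k i).u := hp.primal_sub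
    have e2 : dual β (mu β γ k) (iterate A b c β γ k i).diff =
        WithLp.toLp 2 (iterate A b c β γ k i).v := hp.dual_sub
    rw [e1, e2] at hres
    have e3 : Qop A b c (WithLp.toLp 2 (iterate A b c β γ k i).u) -
        WithLp.toLp 2 (iterate A b c β γ k i).v = WithLp.toLp 2
        ((Q A b c).mulVec (iterate A b c β γ k i).u - (iterate A b c β γ k i).v) := rfl
    rw [e3] at hres
    rw [innerStop]
    calc _ ≤ (K * ‖(iterate A b c β γ k i).diff - w k‖) ^ 2 :=
          pow_le_pow_left₀ (norm_nonneg _) hres 2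
      _ = K ^ 2 * ‖(iterate A b c β γ k i).diff - w k‖ ^ 2 := mul_pow _ _ _
      _ ≤ K ^ 2 * ((1 - ρ * γ ^ k) ^ i * D ^ 2) :=
          mul_le_mul_of_nonneg_left (hconv i) (sq_nonneg K)
      _ = (1 - ρ * γ ^ k) ^ i * B := by rw [hB]; ring
      _ ≤ _ := hgeo
  set M := |Real.log (B / β ^ 3)| + 3 * Real.log γ⁻¹ with hM
  have hlogγ : 0 < Real.log γ⁻¹ := Real.log_pos ((one_lt_inv₀ hγ0).2 hγ1)
  have hM0 : 0 ≤ M := by positivity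
  -- The extra 1 absorbs the rounding in the ceiling, since `(k + 1) γ⁻ᵏ ≥ 1`.
  refine ⟨M / ρ + 1, by positivity, fun k => ?_⟩
  have hceil := hterm k _ (Nat.le_ceil _)
  refine ⟨⟨_, hceil⟩, ?_⟩
  -- The threshold `μ³` decays geometrically, so its logarithm costs only a factor linear in `k`.
  have hlog : Real.log (B / mu β γ k ^ 3) ≤ M * (k + 1) := by
    have e : B / mu β γ k ^ 3 = B / β ^ 3 * (γ⁻¹) ^ (k * 3) := by
      rw [mu_eq, mul_pow, ← pow_mul, inv_pow]; field_simp
    rw [e, Real.log_mul (by positivity) (by positivity), Real.log_pow]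
    push_cast
    have h1 := le_abs_self (Real.log (B / β ^ 3))
    have h2 : 0 ≤ |Real.log (B / β ^ 3)| * k := by positivity
    rw [hM]
    linarith
  have hbd : Real.log (B / mu β γ k ^ 3) / (ρ * γ ^ k) ≤ M / ρ * ((k + 1) * (γ⁻¹) ^ k) := by
    calc _ ≤ M * (k + 1) / (ρ * γ ^ k) := div_le_div_of_nonneg_right hlog (by positivity)
      _ = _ := by rw [inv_pow]; field_simp
  have hone : (1 : ℝ) ≤ (k + 1) * (γ⁻¹) ^ k :=
    one_le_mul_of_one_le_of_one_le (by linarith [k.cast_nonneg (α := ℝ)])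
      (one_le_pow₀ ((one_le_inv₀ hγ0).2 hγ1.le))
  have hN : N A b c β γ k ≤ ⌈M / ρ * ((k + 1) * (γ⁻¹) ^ k)⌉₊ :=
    (Nat.sInf_le hceil).trans (Nat.ceil_mono hbd)
  have hlt := Nat.ceil_lt_add_one (a := M / ρ * ((k + 1) * (γ⁻¹) ^ k)) (by positivity)
  have hN' : (N A b c β γ k : ℝ) ≤ ⌈M / ρ * ((k + 1) * (γ⁻¹) ^ k)⌉₊ := by exact_mod_cast hN
  linarith

end trajectory

/-! ### Summation and asymptotics in `ε` -/

section complexity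

theorem sum_inv_pow_le {γ : ℝ} (hγ0 : 0 < γ) (hγ1 : γ < 1) (T : ℕ) :
    ∑ k ∈ Finset.range (T + 1), (γ⁻¹) ^ k ≤ (γ⁻¹) ^ T / (1 - γ) := by
  have h : 0 < 1 - γ := by linarith
  induction T with
  | zero => simpa using (one_le_inv₀ h).2 (by linarith)
  | succ T ih =>
    rw [Finset.sum_range_succ]
    refine (add_le_add ih le_rfl).trans_eq ?_
    rw [pow_succ]
    field_simp
    ring

theorem exists_mu_lt {β γ ε : ℝ} (hβ : 0 < β) (hγ1 : γ < 1)
    (hε : 0 < ε) :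
    ∃ k : ℕ, mu β γ k < ε := by
  obtain ⟨k, hk⟩ := exists_pow_lt_of_lt_one (div_pos hε hβ) hγ1
  exact ⟨k, by rw [mu_eq]; exact (lt_div_iff₀ hβ).1 hk⟩

/-- By minimality the parameter one step before `T_IPM` is still at least `ε`; `ε ≤ β` guarantees
that such a step exists. -/
theorem inv_pow_T_IPM_le {β γ ε : ℝ} (hβ : 0 < β) (hγ0 : 0 < γ) (hγ1 : γ < 1) (hε : 0 < ε)
    (hεβ : ε ≤ β) : (γ⁻¹) ^ T_IPM β γ ε ≤ γ⁻¹ * (β / ε) := by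
  rcases h : T_IPM β γ ε with _ | t
  · have hmem : mu β γ (T_IPM β γ ε) < ε := Nat.sInf_mem (exists_mu_lt hβ hγ1 hε)
    rw [h] at hmem
    exact absurd hεβ (not_le.2 hmem)
  · have hnot : ¬ mu β γ t < ε := fun hlt => by
      have : T_IPM β γ ε ≤ t := Nat.sInf_le hlt
      omega
    rw [mu_eq, not_lt] at hnot
    rw [pow_succ', inv_pow]
    refine mul_le_mul_of_nonneg_left ?_ (by positivity)
    rw [inv_le_comm₀ (by positivity) (by positivity), inv_div, div_le_iff₀ hβ]
    exact hnot

/-- `T_IPM(ε) + 1` is bounded by a multiple of `log (1/ε)`. -/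
theorem exists_T_IPM_le {β γ : ℝ} (hβ : 0 < β) (hγ0 : 0 < γ) (hγ1 : γ < 1) :
    ∃ C : ℝ, 0 < C ∧ ∀ᶠ ε in 𝓝[>] (0 : ℝ), 0 < ε ∧ ε ≤ β ∧ 0 ≤ Real.log (1 / ε) ∧
      (T_IPM β γ ε : ℝ) + 1 ≤ C * Real.log (1 / ε) := by
  have hl : 0 < Real.log γ⁻¹ := Real.log_pos ((one_lt_inv₀ hγ0).2 hγ1)
  refine ⟨2 + (|Real.log β| + 1) / Real.log γ⁻¹, by positivity, ?_⟩
  -- Below `exp (-1)` the logarithm of `1/ε` is at least 1 and absorbs additive constants.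
  have h1 : ∀ᶠ ε in 𝓝[>] (0 : ℝ), ε ∈ Set.Ioo 0 (min β (Real.exp (-1))) :=
    Ioo_mem_nhdsGT (lt_min hβ (Real.exp_pos _))
  filter_upwards [h1] with ε hε
  have hε0 : 0 < ε := hε.1
  have hεβ : ε ≤ β := (hε.2.trans_le (min_le_left _ _)).le
  have hlog : 1 ≤ Real.log (1 / ε) := by
    have h2 := Real.log_le_log hε0 (hε.2.trans_le (min_le_right _ _)).le
    rw [Real.log_exp] at h2
    rw [one_div, Real.log_inv]
    linarith
  refine ⟨hε0, hεβ, by linarith, ?_⟩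
  have h3 := Real.log_le_log (by positivity) (inv_pow_T_IPM_le hβ hγ0 hγ1 hε0 hεβ)
  rw [Real.log_pow, div_eq_mul_one_div, Real.log_mul (by positivity) (by positivity),
    Real.log_mul (by positivity) (by positivity)] at h3
  have h4 : Real.log β ≤ |Real.log β| * Real.log (1 / ε) :=
    (le_abs_self _).trans (le_mul_of_one_le_right (abs_nonneg _) hlog)
  have h5 : (T_IPM β γ ε : ℝ) ≤
      (Real.log γ⁻¹ + (|Real.log β| + 1) * Real.log (1 / ε)) / Real.log γ⁻¹ := by
    rw [le_div_iff₀ hl]; linarith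
  rw [add_div, div_self hl.ne'] at h5
  calc (T_IPM β γ ε : ℝ) + 1
      ≤ 2 * 1 + (|Real.log β| + 1) * Real.log (1 / ε) / Real.log γ⁻¹ := by linarith
    _ ≤ 2 * Real.log (1 / ε) + (|Real.log β| + 1) * Real.log (1 / ε) / Real.log γ⁻¹ := by linarith
    _ = _ := by ring

theorem T_ADMM_le {m n : ℕ} {A : Matrix (Fin m) (Fin n) ℝ} {b : Fin m → ℝ} {c : Fin n → ℝ}
    {β γ ε C : ℝ} (hβ : 0 < β) (hγ0 : 0 < γ) (hγ1 : γ < 1) (hε : 0 < ε) (hεβ : ε ≤ β)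
    (hC : 0 ≤ C) (hN : ∀ k : ℕ, (N A b c β γ k : ℝ) ≤ C * ((k + 1) * (γ⁻¹) ^ k)) :
    (T_ADMM A b c β γ ε : ℝ) ≤
      C * (γ⁻¹ * β / (1 - γ)) * (1 / ε * (T_IPM β γ ε + 1)) := by
  have hγ : 0 < 1 - γ := by linarith
  set T := T_IPM β γ ε with hT
  rw [T_ADMM, ← hT]
  push_cast
  calc ∑ k ∈ Finset.range (T + 1), (N A b c β γ k : ℝ)
      ≤ ∑ k ∈ Finset.range (T + 1), C * ((T + 1) * (γ⁻¹) ^ k) := by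
        refine Finset.sum_le_sum fun k hk => (hN k).trans ?_
        have hkT : (k : ℝ) ≤ T := by exact_mod_cast Nat.lt_succ_iff.1 (Finset.mem_range.1 hk)
        gcongr
    _ = C * (T + 1) * ∑ k ∈ Finset.range (T + 1), (γ⁻¹) ^ k := by
        rw [Finset.mul_sum]
        exact Finset.sum_congr rfl fun k _ => by ring
    _ ≤ C * (T + 1) * ((γ⁻¹) ^ T / (1 - γ)) :=
        mul_le_mul_of_nonneg_left (sum_inv_pow_le hγ0 hγ1 T) (by positivity)
    _ ≤ C * (T + 1) * (γ⁻¹ * (β / ε) / (1 - γ)) :=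
        mul_le_mul_of_nonneg_left (div_le_div_of_nonneg_right
          (inv_pow_T_IPM_le hβ hγ0 hγ1 hε hεβ) hγ.le) (by positivity)
    _ = _ := by field_simp

end complexity
end ABIP

theorem mainTheorem2 {m n : ℕ} (A : Matrix (Fin m) (Fin n) ℝ) (b : Fin m → ℝ) (c : Fin n → ℝ)
    (hA : A.rank = m) (β γ : ℝ) (hβ : 0 < β) (hγ0 : 0 < γ) (hγ1 : γ < 1) :
    (∀ k : ℕ, ∃ i : ℕ, ABIP.innerStop A b c (ABIP.mu β γ k) (ABIP.iterate A b c β γ k i)) ∧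
    (∀ ε : ℝ, 0 < ε → ∃ k : ℕ, ABIP.mu β γ k < ε) ∧
    (fun ε : ℝ => (ABIP.T_IPM β γ ε : ℝ)) =O[𝓝[>] 0] (fun ε : ℝ => Real.log (1 / ε)) ∧
    (fun ε : ℝ => (ABIP.T_ADMM A b c β γ ε : ℝ)) =O[𝓝[>] 0]
      (fun ε : ℝ => 1 / ε * Real.log (1 / ε)) := by
  obtain ⟨C, hC, hN⟩ := ABIP.exists_N_le A b c hA hβ hγ0 hγ1
  obtain ⟨C', hC', hT⟩ := ABIP.exists_T_IPM_le hβ hγ0 hγ1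
  refine ⟨fun k => (hN k).1, fun ε hε => ABIP.exists_mu_lt hβ hγ1 hε, ?_, ?_⟩
  · refine IsBigO.of_bound C' ?_
    filter_upwards [hT] with ε ⟨_, _, hlog, hle⟩
    rw [Real.norm_of_nonneg (Nat.cast_nonneg _), Real.norm_of_nonneg hlog]
    linarith
  · refine IsBigO.of_bound (C * (γ⁻¹ * β / (1 - γ)) * C') ?_
    filter_upwards [hT] with ε ⟨hε, hεβ, hlog, hle⟩
    have h1 := ABIP.T_ADMM_le hβ hγ0 hγ1 hε hεβ hC.le fun k => (hN k).2
    have hγ : 0 < 1 - γ := by linarith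
    rw [Real.norm_of_nonneg (Nat.cast_nonneg _), Real.norm_of_nonneg (by positivity)]
    calc (ABIP.T_ADMM A b c β γ ε : ℝ) ≤ _ := h1
      _ ≤ C * (γ⁻¹ * β / (1 - γ)) * (1 / ε * (C' * Real.log (1 / ε))) := by gcongr
      _ = _ := by ring
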